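/- **Setting.** Let $m\ge 0$, $n\ge 1$, let $M$ be a smooth (Hausdorff, second countable) parallelizable manifold of dimension $m$ with a chosen global frame $e_1,\dots,e_m$ of smooth vector fields, and let $\lambda_1,\dots,\lambda_{n^2-1}$ be a basis of $\mathfrak{sl}_n(\mathbb C)$. Put $A=C^\infty(M)\otimes M_n(\mathbb C)=M_n(C^\infty(M))$, where $C^\infty(M)$ denotes the complex-valued smooth functions; let $Z(A)$ be its centre, $\mathrm{Der}\,A$ the $Z(A)$-module of $\mathbb C$-linear derivations of $A$, and $A^1=\mathrm{Hom}_{Z(A)}(\mathrm{Der}\,A,A)$ the $A$-bimodule of derivation-based 1-forms, with $(a\alpha b)(X)=a\,\alpha(X)\,b$. The vector fields $e_1,\dots,e_m$ (applied to each matrix entry) together with $e_{m+r}=\mathrm{ad}\,\lambda_r\colon a\mapsto \lambda_r a-a\lambda_r$, $1\le r\le n^2-1$, are derivations of $A$. All tensor products without subscript are over $\mathbb C$. For $t=\sum_k\alpha_k\otimes\beta_k\in A^1\otimes A^1$ and $X,Y\in\mathrm{Der}\,A$ write $t(X,Y)=\sum_k\alpha_k(X)\otimes\beta_k(Y)\in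 A\otimes_{Z(A)}A$. Let $\tau$ be a bimodule automorphism of $A^1\otimes A^1$ (for the action $a(\alpha\otimes\beta)b=a\alpha\otimes\beta b$) that is the pullback of the permutation, that is, $\tau(t)(X,Y)=t(Y,X)$ for all $t$, $X$, $Y$. A *($\tau$-symmetric) metric* on $A^1$ is a $\mathbb C$-linear map $g\colon A^1\otimes A^1\to A$ with $g(a\zeta\otimes\rho b)=a\,g(\zeta\otimes\rho)\,b$ for all $a,b\in A$, $\zeta,\rho\in A^1$, and $g\circ\tau=g$. It is *middle-linear* if $g(\zeta a\otimes\rho)=g(\zeta\otimes a\rho)$ for all $a\in A$, $\zeta,\rho\in A^1$. **Proposition.** There is exactly one family $\theta^1,\dots,\theta^{m+n^2-1}$ in $A^1$ with $\theta^i(e_j)=\delta^i_j\,1$, and automorphisms $\tau$ as above exist. For this family and for every such $\tau$, the map $$\psi\colon g\longmapsto (g^{ij}),\qquad g^{ij}=g(\theta^i\otimes\theta^j),\quad i,j\in\{1,\dots,m+n^2-1\},$$ is a bijection from the set of metrics on $A^1$ onto the set of symmetric matrices ($G^{ij}=G^{ji}$) in $M_{m+n^2-1}(A)$, and the same map restricts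 to a bijection from the set of middle-linear metrics on $A^1$ onto the set of symmetric matrices in $M_{m+n^2-1}(Z(A))$. -/

import Mathlib

open scoped Manifold ContDiff TensorProduct Bundle

noncomputable section

/-! ### Derivations, one-forms and metrics for an arbitrary complex algebra -/

section General

variable (A : Type*) [Ring A] [Algebra ℂ A]

/-- The centre `Z(A)`. -/
abbrev Zcenter : Subalgebra ℂ A := Subalgebra.center ℂ A

/-- `Der A`: the `ℂ`-linear derivations of `A`, a `Z(A)`-module by `(z D)(a) = z * D a`. -/
def Der : Submodule (Zcenter A) (A →ₗ[ℂ] A) where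
  carrier := {D | ∀ a b : A, D (a * b) = D a * b + a * D b}
  add_mem' := by
    intro D D' h h' a b
    simp only [Set.mem_ofPred_eq] at h h'
    simp only [LinearMap.add_apply, h, h', add_mul, mul_add]
    abel
  zero_mem' := by
    intro a b
    simp
  smul_mem' := by
    intro z D h a b
    have hz : a * (z : A) = (z : A) * a := Subalgebra.mem_center_iff.1 z.2 a
    simp only [Set.mem_ofPred_eq] at h
    simp only [LinearMap.smul_apply, Subalgebra.smul_def, smul_eq_mul, h, mul_add]
    rw [← mul_assoc a, hz, mul_assoc, mul_assoc]

/-- `A¹ = Hom_{Z(A)}(Der A, A)`, the derivation-based one-forms. -/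
abbrev OneForm : Type _ := Der A →ₗ[Zcenter A] A

variable {A}

/-- The left module structure of `A¹`: `(a α)(X) = a * α X`. -/
def OneForm.lmul (a : A) : OneForm A →ₗ[ℂ] OneForm A where
  toFun α :=
    { toFun := fun X => a * α X
      map_add' := fun X Y => by rw [map_add, mul_add]
      map_smul' := fun z X => by
        have hz : a * (z : A) = (z : A) * a := Subalgebra.mem_center_iff.1 z.2 a
        simp only [map_smul, Subalgebra.smul_def, smul_eq_mul, RingHom.id_apply]
        rw [← mul_assoc, hz, mul_assoc] }
  map_add' α β := by
    ext X
    exact mul_add a (α X) (β X)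
  map_smul' c α := by
    ext X
    exact mul_smul_comm c a (α X)

/-- The right module structure of `A¹`: `(α a)(X) = α X * a`. -/
def OneForm.rmul (a : A) : OneForm A →ₗ[ℂ] OneForm A where
  toFun α :=
    { toFun := fun X => α X * a
      map_add' := fun X Y => by rw [map_add, add_mul]
      map_smul' := fun z X => by
        simp only [map_smul, Subalgebra.smul_def, smul_eq_mul, RingHom.id_apply, mul_assoc] }
  map_add' α β := by
    ext X
    exact add_mul (α X) (β X) a
  map_smul' c α := by
    ext X
    exact smul_mul_assoc c (α X) a

/-- The value `(α ⊗ β)(X, Y) = α X ⊗ β Y ∈ A ⊗_{Z(A)} A` of an element of `A¹ ⊗ A¹` on a pair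
of derivations. -/
def evalPair (X Y : Der A) : OneForm A ⊗[ℂ] OneForm A →ₗ[ℂ] A ⊗[Zcenter A] A :=
  TensorProduct.lift <| LinearMap.mk₂ ℂ (fun α β : OneForm A => α X ⊗ₜ[Zcenter A] β Y)
    (fun α α' β => TensorProduct.add_tmul (α X) (α' X) (β Y))
    (fun c α β => (TensorProduct.smul_tmul' c (α X) (β Y)).symm)
    (fun α β β' => TensorProduct.tmul_add (α X) (β Y) (β' Y))
    (fun c α β => TensorProduct.tmul_smul c (α X) (β Y))

/-- `τ` is an automorphism of the `A`-bimodule `A¹ ⊗ A¹` (outer left and right actions) that is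
the pullback of the permutation: `(τ t)(X, Y) = t(Y, X)`. -/
structure IsPermutationPullback
    (τ : (OneForm A ⊗[ℂ] OneForm A) ≃ₗ[ℂ] (OneForm A ⊗[ℂ] OneForm A)) : Prop where
  map_bimodule : ∀ (a b : A) (t : OneForm A ⊗[ℂ] OneForm A),
    τ (TensorProduct.map (OneForm.lmul a) (OneForm.rmul b) t) =
      TensorProduct.map (OneForm.lmul a) (OneForm.rmul b) (τ t)
  eval_swap : ∀ (t : OneForm A ⊗[ℂ] OneForm A) (X Y : Der A),
    evalPair X Y (τ t) = evalPair Y X t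

/-- A `τ`-symmetric metric: a linear map `g : A¹ ⊗ A¹ → A` with `g(aζ, ρb) = a g(ζ, ρ) b` and
`g ∘ τ = g`. -/
structure IsMetric
    (τ : (OneForm A ⊗[ℂ] OneForm A) ≃ₗ[ℂ] (OneForm A ⊗[ℂ] OneForm A))
    (g : OneForm A ⊗[ℂ] OneForm A →ₗ[ℂ] A) : Prop where
  bilinear : ∀ (a b : A) (ζ ρ : OneForm A),
    g (OneForm.lmul a ζ ⊗ₜ[ℂ] OneForm.rmul b ρ) = a * g (ζ ⊗ₜ[ℂ] ρ) * b
  symmetric : g ∘ₗ τ.toLinearMap = g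

/-- Middle-linearity: `g(ζa, ρ) = g(ζ, aρ)`, i.e. `g` descends to `A¹ ⊗_A A¹`. -/
def IsMiddleLinear (g : OneForm A ⊗[ℂ] OneForm A →ₗ[ℂ] A) : Prop :=
  ∀ (a : A) (ζ ρ : OneForm A),
    g (OneForm.rmul a ζ ⊗ₜ[ℂ] ρ) = g (ζ ⊗ₜ[ℂ] OneForm.lmul a ρ)

/-- The matrix `g^{ij} = g(θ^i ⊗ θ^j)`. -/
def metricMatrix {ι : Type*} (θ : ι → OneForm A) (g : OneForm A ⊗[ℂ] OneForm A →ₗ[ℂ] A) :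
    Matrix ι ι A :=
  Matrix.of fun i j => g (θ i ⊗ₜ[ℂ] θ j)

/-- `θ` is the family of one-forms dual to the family `e` of derivations. -/
def IsDualFamily {ι : Type*} [DecidableEq ι] (e : ι → Der A) (θ : ι → OneForm A) : Prop :=
  ∀ i j, θ i (e j) = if i = j then 1 else 0

/-- The inner derivation `ad a : b ↦ a b - b a`. -/
def innerDer (a : A) : Der A :=
  ⟨LinearMap.mulLeft ℂ a - LinearMap.mulRight ℂ a, by
    intro b c
    simp only [LinearMap.sub_apply, LinearMap.mulLeft_apply, LinearMap.mulRight_apply]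
    noncomm_ring⟩

end General

/-! ### Matrix-valued functions on a manifold -/

section Manifold

/-- The field `ℂ` is a smooth ring as a real manifold. -/
instance complexContMDiffRing : ContMDiffRing 𝓘(ℝ, ℂ) ∞ ℂ where
  toContMDiffAdd := inferInstance
  contMDiff_mul := by
    rw [contMDiff_iff]
    refine ⟨continuous_mul, fun x y => ?_⟩
    simp only [mfld_simps, chartAt_self_eq]
    rw [contDiffOn_univ]
    exact contDiff_mul

variable (m : ℕ) (M : Type*) [TopologicalSpace M] [ChartedSpace (EuclideanSpace ℝ (Fin m)) M]

/-- `C^∞(M)`: the smooth complex-valued functions on the `m`-dimensional manifold `M`. -/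
abbrev SmoothFun : Type _ := C^∞⟮𝓡 m, M; 𝓘(ℝ, ℂ), ℂ⟯

/-- Complex constants as smooth functions. -/
def SmoothFun.const : ℂ →+* SmoothFun m M where
  toFun c := ⟨fun _ => c, contMDiff_const⟩
  map_one' := rfl
  map_mul' _ _ := rfl
  map_zero' := rfl
  map_add' _ _ := rfl

/-- `C^∞(M)` as an algebra over the complex numbers. -/
instance SmoothFun.complexAlgebra : Algebra ℂ (SmoothFun m M) := (SmoothFun.const m M).toAlgebra

/-- `A = C^∞(M) ⊗ M_n(ℂ)`, as the algebra `M_n(C^∞(M))` of matrix-valued functions. -/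
abbrev MatFun (n : ℕ) : Type _ := Matrix (Fin n) (Fin n) (SmoothFun m M)

variable {m M} [IsManifold (𝓡 m) ∞ M]

/-- Smooth vector fields on `M`. -/
abbrev SmoothVF (m : ℕ) (M : Type*) [TopologicalSpace M]
    [ChartedSpace (EuclideanSpace ℝ (Fin m)) M] [IsManifold (𝓡 m) ∞ M] : Type _ :=
  Cₛ^∞⟮𝓡 m; EuclideanSpace ℝ (Fin m), (TangentSpace (𝓡 m) : M → Type _)⟯

/-- The derivative `V f` of a complex-valued smooth function `f` along a vector field `V`:
`(V f)(x) = df_x (V x)`. -/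
def SmoothVF.apply (V : SmoothVF m M) (f : SmoothFun m M) : SmoothFun m M :=
  ⟨fun x => mfderiv (𝓡 m) 𝓘(ℝ, ℂ) f x (V x), by
    have h := (f.contMDiff.contMDiff_tangentMap (m := ∞) le_rfl).comp V.contMDiff
    exact (contMDiff_snd_tangentBundle_modelSpace ℂ 𝓘(ℝ, ℂ)).comp h⟩

theorem SmoothVF.apply_add (V : SmoothVF m M) (f g : SmoothFun m M) :
    V.apply (f + g) = V.apply f + V.apply g := by
  ext x
  have hf : MDifferentiableAt (𝓡 m) 𝓘(ℝ, ℂ) f x := f.contMDiff.mdifferentiableAt (by simp)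
  have hg : MDifferentiableAt (𝓡 m) 𝓘(ℝ, ℂ) g x := g.contMDiff.mdifferentiableAt (by simp)
  have h := (hf.hasMFDerivAt.add hg.hasMFDerivAt).mfderiv
  exact DFunLike.congr_fun h (V x)

theorem SmoothVF.apply_mul (V : SmoothVF m M) (f g : SmoothFun m M) :
    V.apply (f * g) = V.apply f * g + f * V.apply g := by
  ext x
  have hf : MDifferentiableAt (𝓡 m) 𝓘(ℝ, ℂ) f x := f.contMDiff.mdifferentiableAt (by simp)
  have hg : MDifferentiableAt (𝓡 m) 𝓘(ℝ, ℂ) g x := g.contMDiff.mdifferentiableAt (by simp)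
  have h := (hf.hasMFDerivAt.mul hg.hasMFDerivAt).mfderiv
  refine (DFunLike.congr_fun h (V x)).trans ?_
  change f x * _ + g x * _ = _ * g x + f x * _
  rw [mul_comm (g x), add_comm]
  rfl

theorem SmoothVF.apply_const (V : SmoothVF m M) (c : ℂ) :
    V.apply (SmoothFun.const m M c) = 0 := by
  ext x
  have h := (hasMFDerivAt_const (I := 𝓡 m) (I' := 𝓘(ℝ, ℂ)) c x).mfderiv
  exact DFunLike.congr_fun h (V x)

/-- The derivation of `A` that applies a vector field to every matrix entry. -/
def SmoothVF.toDer (n : ℕ) (V : SmoothVF m M) : Der (MatFun m M n) :=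
  ⟨{ toFun := fun a => a.map V.apply
     map_add' := fun a b => by
       ext1 i j
       exact V.apply_add (a i j) (b i j)
     map_smul' := fun c a => by
       ext1 i j
       have h : V.apply (SmoothFun.const m M c * a i j)
           = SmoothFun.const m M c * V.apply (a i j) := by
         rw [V.apply_mul, V.apply_const, zero_mul, zero_add]
       exact h }, by
    intro a b
    ext1 i j
    have hsum : ∀ (s : Finset (Fin n)) (u : Fin n → SmoothFun m M),
        V.apply (∑ k ∈ s, u k) = ∑ k ∈ s, V.apply (u k) :=
      fun s u => map_sum (AddMonoidHom.mk' V.apply V.apply_add) u s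
    change V.apply ((a * b) i j) = (a.map V.apply * b + a * b.map V.apply) i j
    simp only [Matrix.mul_apply, Matrix.add_apply, Matrix.map_apply, hsum, V.apply_mul,
      Finset.sum_add_distrib]⟩

/-- The derivations `e_1, …, e_{m+n²-1}` of `A` given by vector fields `e_1, …, e_m` on `M` and
by `ad λ_1, …, ad λ_{n²-1}`, where the `λ_r` are traceless complex matrices, viewed as constant
functions. -/
def frameDer (n : ℕ) (e : Fin m → SmoothVF m M)
    (lam : Fin (n ^ 2 - 1) → LieAlgebra.SpecialLinear.sl (Fin n) ℂ) :
    Fin (m + (n ^ 2 - 1)) → Der (MatFun m M n) :=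
  Fin.append (fun α => (e α).toDer n)
    (fun r => innerDer ((lam r : Matrix (Fin n) (Fin n) ℂ).map (SmoothFun.const m M)))

end Manifold

end

/-! Everything is formal once the derivations `e i` are known to be a basis of `Der A` over `Z(A)`
(`metrics_of_basis`). The `θ i` are then the coordinate functions; their values are central, so `θ
i` commutes with `A`, and every one-form is `ζ = ∑ ζ(e i) θ i = ∑ θ i ζ(e i)`. Outer bilinearity
forces `g(ζ ⊗ ρ) = ∑ ζ(e i) g^{ij} ρ(e j)`, and any matrix defines such a `g`. This formula sees a
tensor only through its values on the pairs `(e i, e j)`, so composing with any `τ` transposes the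
matrix. As `a θ i = θ i a`, middle-linearity says that each `g^{ij}` commutes with `A`. Exchanging
`θ i` and `θ j` in `a θ i ⊗ θ j b` gives one `τ`.

The basis (`exists_basis_frameDer`): put `C = C^∞(M)`. A derivation of `M_n(C)` preserves the
centre, so it induces a derivation of `C`. By Hadamard's lemma at each point, and Cramer's rule for
smoothness, this is `∑ c α • e α` with smooth complex coefficients. Subtracting that sum leaves a
derivation killing the centre, which is the commutator with a traceless matrix, a unique
`C`-combination of the `λ r`. -/

noncomputable section

/-! ### Metrics and permutation pullbacks when `Der A` has a finite basis over the centre. -/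

section FrameAlgebra

variable {A : Type*} [Ring A] [Algebra ℂ A]

@[simp]
theorem OneForm.lmul_apply (a : A) (α : OneForm A) (X : Der A) :
    OneForm.lmul a α X = a * α X := rfl

@[simp]
theorem OneForm.rmul_apply (a : A) (α : OneForm A) (X : Der A) :
    OneForm.rmul a α X = α X * a := rfl

@[simp]
theorem evalPair_tmul (X Y : Der A) (α β : OneForm A) :
    evalPair X Y (α ⊗ₜ[ℂ] β) = α X ⊗ₜ[Zcenter A] β Y := rfl

theorem central_mul_tmul_mul (z w : Zcenter A) (a b : A) :
    (a * (z : A)) ⊗ₜ[Zcenter A] ((w : A) * b) = (a * (w : A)) ⊗ₜ[Zcenter A] ((z : A) * b) := by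
  have h (z : Zcenter A) : a * (z : A) = z • a := Subalgebra.mem_center_iff.1 z.2 a
  have h' (z : Zcenter A) : (z : A) * b = z • b := rfl
  rw [h, h, h', h', TensorProduct.smul_tmul, TensorProduct.smul_tmul, smul_smul, smul_smul,
    mul_comm]

/-- The map `a ⊗ b ↦ a * G * b` on `A ⊗_{Z(A)} A`. -/
def sandwich (G : A) : A ⊗[Zcenter A] A →ₗ[ℂ] A :=
  (TensorProduct.lift <| LinearMap.mk₂ (Zcenter A) (fun a b : A => a * G * b)
    (fun a a' b => by simp only [add_mul])
    (fun z a b => by simp only [Subalgebra.smul_def, smul_eq_mul, mul_assoc])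
    (fun a b b' => by simp only [mul_add])
    (fun z a b => by
      have hz := Subalgebra.mem_center_iff.1 z.2 (a * G)
      simp only [Subalgebra.smul_def, smul_eq_mul, ← mul_assoc, hz])).restrictScalars ℂ

@[simp]
theorem sandwich_tmul (G a b : A) : sandwich G (a ⊗ₜ[Zcenter A] b) = a * G * b := rfl

variable {ι : Type*} [Fintype ι]

/-- The contraction of `A¹ ⊗ A¹` with a matrix along a family of derivations:
`ζ ⊗ ρ ↦ ∑ ζ(e_i) * G^{ij} * ρ(e_j)`. -/
def contraction (e : ι → Der A) (G : Matrix ι ι A) : OneForm A ⊗[ℂ] OneForm A →ₗ[ℂ] A :=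
  ∑ i, ∑ j, sandwich (G i j) ∘ₗ evalPair (e i) (e j)

theorem contraction_apply (e : ι → Der A) (G : Matrix ι ι A) (t : OneForm A ⊗[ℂ] OneForm A) :
    contraction e G t = ∑ i, ∑ j, sandwich (G i j) (evalPair (e i) (e j) t) := by
  simp only [contraction, LinearMap.sum_apply, LinearMap.comp_apply]

theorem contraction_tmul (e : ι → Der A) (G : Matrix ι ι A) (ζ ρ : OneForm A) :
    contraction e G (ζ ⊗ₜ[ℂ] ρ) = ∑ i, ∑ j, ζ (e i) * G i j * ρ (e j) := by
  simp [contraction_apply]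

/-- A contraction factors through the values on pairs of derivations, the only thing known about
`τ`; no uniqueness of `τ` is needed. -/
theorem contraction_apply_swap (e : ι → Der A) {G : Matrix ι ι A} (hG : G.IsSymm)
    {τ : (OneForm A ⊗[ℂ] OneForm A) ≃ₗ[ℂ] (OneForm A ⊗[ℂ] OneForm A)}
    (hτ : IsPermutationPullback τ) (t : OneForm A ⊗[ℂ] OneForm A) :
    contraction e G (τ t) = contraction e G t := by
  rw [contraction_apply, contraction_apply, Finset.sum_comm]
  refine Finset.sum_congr rfl fun i _ => Finset.sum_congr rfl fun j _ => ?_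
  rw [hτ.eval_swap, hG.apply]

theorem contraction_bilinear (e : ι → Der A) (G : Matrix ι ι A) (a b : A) (ζ ρ : OneForm A) :
    contraction e G (OneForm.lmul a ζ ⊗ₜ[ℂ] OneForm.rmul b ρ) =
      a * contraction e G (ζ ⊗ₜ[ℂ] ρ) * b := by
  simp only [contraction_tmul, OneForm.lmul_apply, OneForm.rmul_apply, Finset.mul_sum,
    Finset.sum_mul, mul_assoc]

theorem isMiddleLinear_contraction (e : ι → Der A) {G : Matrix ι ι A}
    (hG : ∀ i j, G i j ∈ Subalgebra.center ℂ A) : IsMiddleLinear (contraction e G) := by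
  intro a ζ ρ
  simp only [contraction_tmul, OneForm.lmul_apply, OneForm.rmul_apply]
  refine Finset.sum_congr rfl fun i _ => Finset.sum_congr rfl fun j _ => ?_
  rw [mul_assoc (ζ (e i)), Subalgebra.mem_center_iff.1 (hG i j) a]
  simp only [mul_assoc]

/-- The endomorphism `ζ ⊗ ρ ↦ ∑ ζ(e_i) θ^j ⊗ θ^i ρ(e_j)` of `A¹ ⊗ A¹`. -/
def frameSwap (e : ι → Der A) (θ : ι → OneForm A) :
    OneForm A ⊗[ℂ] OneForm A →ₗ[ℂ] OneForm A ⊗[ℂ] OneForm A :=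
  TensorProduct.lift <| LinearMap.mk₂ ℂ
    (fun ζ ρ => ∑ i, ∑ j, OneForm.lmul (ζ (e i)) (θ j) ⊗ₜ[ℂ] OneForm.rmul (ρ (e j)) (θ i))
    (fun ζ ζ' ρ => by
      have h (a a' : A) (α : OneForm A) :
          OneForm.lmul (a + a') α = OneForm.lmul a α + OneForm.lmul a' α :=
        LinearMap.ext fun X => add_mul _ _ _
      simp only [LinearMap.add_apply, h, TensorProduct.add_tmul, Finset.sum_add_distrib])
    (fun c ζ ρ => by
      have h (a : A) (α : OneForm A) : OneForm.lmul (c • a) α = c • OneForm.lmul a α :=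
        LinearMap.ext fun X => smul_mul_assoc _ _ _
      simp only [LinearMap.smul_apply, h, ← TensorProduct.smul_tmul', Finset.smul_sum])
    (fun ζ ρ ρ' => by
      have h (a a' : A) (α : OneForm A) :
          OneForm.rmul (a + a') α = OneForm.rmul a α + OneForm.rmul a' α :=
        LinearMap.ext fun X => mul_add _ _ _
      simp only [LinearMap.add_apply, h, TensorProduct.tmul_add, Finset.sum_add_distrib])
    (fun c ζ ρ => by
      have h (a : A) (α : OneForm A) : OneForm.rmul (c • a) α = c • OneForm.rmul a α :=
        LinearMap.ext fun X => mul_smul_comm _ _ _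
      simp only [LinearMap.smul_apply, h, TensorProduct.tmul_smul, Finset.smul_sum])

theorem frameSwap_tmul (e : ι → Der A) (θ : ι → OneForm A) (ζ ρ : OneForm A) :
    frameSwap e θ (ζ ⊗ₜ[ℂ] ρ) =
      ∑ i, ∑ j, OneForm.lmul (ζ (e i)) (θ j) ⊗ₜ[ℂ] OneForm.rmul (ρ (e j)) (θ i) := rfl

variable [DecidableEq ι]

theorem existsUnique_isDualFamily (b : Module.Basis ι (Zcenter A) (Der A)) :
    ∃! θ : ι → OneForm A, IsDualFamily b θ := by
  refine ⟨fun i => LinearMap.toSpanSingleton (Zcenter A) A 1 ∘ₗ b.coord i, fun i j => ?_, fun θ hθ => ?_⟩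
  · by_cases h : i = j
    · subst h; simp
    · simp [h]
  · funext i
    refine b.ext fun j => ?_
    rw [hθ i j]
    by_cases h : i = j
    · subst h; simp
    · simp [h]

variable {b : Module.Basis ι (Zcenter A) (Der A)} {θ : ι → OneForm A}

theorem IsDualFamily.apply_eq (hθ : IsDualFamily b θ) (i : ι) (X : Der A) :
    θ i X = b.repr X i := by
  conv_lhs => rw [← b.sum_repr X]
  rw [map_sum, Finset.sum_eq_single i]
  · rw [map_smul, hθ i i, if_pos rfl, Subalgebra.smul_def, smul_eq_mul, mul_one]
  · intro j _ hj
    rw [map_smul, hθ i j, if_neg hj.symm, smul_zero]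
  · simp

theorem IsDualFamily.commute (hθ : IsDualFamily b θ) (i : ι) (X : Der A) (a : A) :
    a * θ i X = θ i X * a := by
  rw [hθ.apply_eq]
  exact Subalgebra.mem_center_iff.1 (b.repr X i).2 a

theorem IsDualFamily.rmul_eq_lmul (hθ : IsDualFamily b θ) (i : ι) (a : A) :
    OneForm.rmul a (θ i) = OneForm.lmul a (θ i) := by
  ext X
  exact (hθ.commute i X a).symm

theorem IsDualFamily.sum_lmul (hθ : IsDualFamily b θ) (ζ : OneForm A) :
    ∑ i, OneForm.lmul (ζ (b i)) (θ i) = ζ := by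
  refine b.ext fun j => ?_
  simp [LinearMap.sum_apply, hθ _ j]

theorem IsDualFamily.sum_rmul (hθ : IsDualFamily b θ) (ζ : OneForm A) :
    ∑ i, OneForm.rmul (ζ (b i)) (θ i) = ζ := by
  simp only [hθ.rmul_eq_lmul, hθ.sum_lmul]

theorem IsDualFamily.contraction_dual (hθ : IsDualFamily b θ) (G : Matrix ι ι A) (i j : ι) :
    contraction b G (θ i ⊗ₜ[ℂ] θ j) = G i j := by
  simp [contraction_tmul, hθ _ _]

theorem IsDualFamily.eq_contraction (hθ : IsDualFamily b θ)
    {g : OneForm A ⊗[ℂ] OneForm A →ₗ[ℂ] A}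
    (hg : ∀ (a b : A) (ζ ρ : OneForm A),
      g (OneForm.lmul a ζ ⊗ₜ[ℂ] OneForm.rmul b ρ) = a * g (ζ ⊗ₜ[ℂ] ρ) * b) :
    g = contraction b (metricMatrix θ g) := by
  refine TensorProduct.ext' fun ζ ρ => ?_
  -- Only outer factors can be pulled out of `g`, so the coefficients of `ζ` go to the left and
  -- those of `ρ` to the right.
  conv_lhs => rw [← hθ.sum_lmul ζ, ← hθ.sum_rmul ρ]
  simp only [TensorProduct.sum_tmul, TensorProduct.tmul_sum, map_sum, hg, contraction_tmul,
    metricMatrix, Matrix.of_apply]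
  exact Finset.sum_comm

theorem IsDualFamily.bijOn_metricMatrix (hθ : IsDualFamily b θ)
    {τ : (OneForm A ⊗[ℂ] OneForm A) ≃ₗ[ℂ] (OneForm A ⊗[ℂ] OneForm A)}
    (hτ : IsPermutationPullback τ) :
    Set.BijOn (metricMatrix θ) {g | IsMetric τ g} {G | G.IsSymm} := by
  refine ⟨fun g hg => ?_, fun g hg g' hg' h => ?_, fun G hG => ?_⟩
  · refine Matrix.IsSymm.ext fun i j => ?_
    have hsymm : g (τ (θ i ⊗ₜ[ℂ] θ j)) = g (θ i ⊗ₜ[ℂ] θ j) :=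
      DFunLike.congr_fun hg.symmetric _
    change g (θ j ⊗ₜ[ℂ] θ i) = g (θ i ⊗ₜ[ℂ] θ j)
    rw [← hsymm]
    -- As a contraction, `g` reads `τ (θ i ⊗ θ j)` only on frame pairs, where `eval_swap` exchanges
    -- the indices.
    conv_rhs => rw [hθ.eq_contraction hg.bilinear]
    simp [contraction_apply, hτ.eval_swap, hθ _ _, TensorProduct.ite_tmul,
      apply_ite, metricMatrix]
  · rw [hθ.eq_contraction hg.bilinear, hθ.eq_contraction hg'.bilinear, h]
  · refine ⟨contraction b G, ⟨contraction_bilinear _ _, ?_⟩, ?_⟩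
    · exact LinearMap.ext fun t => contraction_apply_swap b hG hτ t
    · ext1 i j
      exact hθ.contraction_dual G i j

theorem IsDualFamily.bijOn_metricMatrix_middleLinear (hθ : IsDualFamily b θ)
    {τ : (OneForm A ⊗[ℂ] OneForm A) ≃ₗ[ℂ] (OneForm A ⊗[ℂ] OneForm A)}
    (hτ : IsPermutationPullback τ) :
    Set.BijOn (metricMatrix θ) {g | IsMetric τ g ∧ IsMiddleLinear g}
      {G | G.IsSymm ∧ ∀ i j, G i j ∈ Subalgebra.center ℂ A} := by
  have hbij := hθ.bijOn_metricMatrix hτ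
  refine ⟨fun g hg => ⟨hbij.mapsTo hg.1, fun i j => ?_⟩, hbij.injOn.mono fun g hg => hg.1,
    fun G hG => ?_⟩
  · refine Subalgebra.mem_center_iff.2 fun a => ?_
    change a * g (θ i ⊗ₜ[ℂ] θ j) = g (θ i ⊗ₜ[ℂ] θ j) * a
    have hone : ∀ ζ : OneForm A, OneForm.rmul 1 ζ = ζ ∧ OneForm.lmul 1 ζ = ζ := fun ζ =>
      ⟨LinearMap.ext fun X => mul_one _, LinearMap.ext fun X => one_mul _⟩
    have hl := hg.1.bilinear a 1 (θ i) (θ j)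
    have hr := hg.1.bilinear 1 a (θ i) (θ j)
    rw [(hone _).1, mul_one] at hl
    rw [(hone _).2, one_mul] at hr
    -- `a g^{ij} = g(aθ^i ⊗ θ^j) = g(θ^i a ⊗ θ^j) = g(θ^i ⊗ aθ^j) = g(θ^i ⊗ θ^j a) = g^{ij} a`.
    rw [← hl, ← hr, ← hθ.rmul_eq_lmul, hg.2, hθ.rmul_eq_lmul]
  · refine ⟨contraction b G, ⟨⟨contraction_bilinear _ _, ?_⟩,
      isMiddleLinear_contraction _ hG.2⟩, ?_⟩
    · exact LinearMap.ext fun t => contraction_apply_swap b hG.1 hτ t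
    · ext1 i j
      exact hθ.contraction_dual G i j

/-- When `e` is a basis these tensors span, so the involution property can be read off from this
formula. -/
theorem IsDualFamily.frameSwap_lmul_rmul {e : ι → Der A} (hθ : IsDualFamily e θ) (a b : A)
    (i j : ι) : frameSwap e θ (OneForm.lmul a (θ i) ⊗ₜ[ℂ] OneForm.rmul b (θ j)) =
      OneForm.lmul a (θ j) ⊗ₜ[ℂ] OneForm.rmul b (θ i) := by
  have hl (α : OneForm A) : OneForm.lmul 0 α = 0 := LinearMap.ext fun X => zero_mul _
  have hr (α : OneForm A) : OneForm.rmul 0 α = 0 := LinearMap.ext fun X => mul_zero _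
  rw [frameSwap_tmul, Finset.sum_eq_single i, Finset.sum_eq_single j]
  · simp [hθ _ _]
  · intro k _ hk
    simp [hθ _ _, Ne.symm hk, hr]
  · simp
  · intro k _ hk
    simp [hθ _ _, Ne.symm hk, hl]
  · simp

theorem IsDualFamily.frameSwap_involutive (hθ : IsDualFamily b θ) :
    Function.Involutive (frameSwap b θ) := by
  have h : frameSwap b θ ∘ₗ frameSwap b θ = LinearMap.id := by
    refine TensorProduct.ext' fun ζ ρ => ?_
    rw [LinearMap.comp_apply, frameSwap_tmul]
    simp only [map_sum, hθ.frameSwap_lmul_rmul]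
    conv_rhs => rw [LinearMap.id_apply, ← hθ.sum_lmul ζ, ← hθ.sum_rmul ρ]
    simp only [TensorProduct.sum_tmul, TensorProduct.tmul_sum]
    exact Finset.sum_comm
  exact fun t => DFunLike.congr_fun h t

theorem IsDualFamily.exists_isPermutationPullback (hθ : IsDualFamily b θ) :
    ∃ τ : (OneForm A ⊗[ℂ] OneForm A) ≃ₗ[ℂ] (OneForm A ⊗[ℂ] OneForm A),
      IsPermutationPullback τ := by
  refine ⟨LinearEquiv.ofInvolutive (frameSwap b θ) hθ.frameSwap_involutive, ⟨?_, ?_⟩⟩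
  · intro a c t
    change frameSwap b θ _ = TensorProduct.map _ _ (frameSwap b θ t)
    induction t with
    | zero => simp
    | add x y hx hy => simp only [map_add, hx, hy]
    | tmul ζ ρ =>
      have hl (a' : A) (α : OneForm A) :
          OneForm.lmul (a * a') α = OneForm.lmul a (OneForm.lmul a' α) :=
        LinearMap.ext fun X => mul_assoc _ _ _
      have hr (a' : A) (α : OneForm A) :
          OneForm.rmul (a' * c) α = OneForm.rmul c (OneForm.rmul a' α) :=
        LinearMap.ext fun X => (mul_assoc _ _ _).symm
      simp only [TensorProduct.map_tmul, frameSwap_tmul, map_sum, OneForm.lmul_apply,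
        OneForm.rmul_apply, hl, hr]
  · intro t X Y
    change evalPair X Y (frameSwap b θ t) = _
    induction t with
    | zero => simp
    | add x y hx hy => simp only [map_add, hx, hy]
    | tmul ζ ρ =>
      conv_rhs => rw [← hθ.sum_lmul ζ, ← hθ.sum_rmul ρ]
      simp only [frameSwap_tmul, map_sum, TensorProduct.sum_tmul, TensorProduct.tmul_sum,
        evalPair_tmul, OneForm.lmul_apply, OneForm.rmul_apply]
      rw [Finset.sum_comm]
      refine Finset.sum_congr rfl fun j _ => Finset.sum_congr rfl fun i _ => ?_
      simp only [hθ.apply_eq]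
      -- The values of `θ` are central, so they may cross the tensor sign over `Z(A)` and trade
      -- places.
      exact central_mul_tmul_mul _ _ _ _

theorem metrics_of_basis {e : ι → Der A} (he : ∃ b : Module.Basis ι (Zcenter A) (Der A), ⇑b = e) :
    (∃! θ : ι → OneForm A, IsDualFamily e θ) ∧
    (∃ τ : (OneForm A ⊗[ℂ] OneForm A) ≃ₗ[ℂ] (OneForm A ⊗[ℂ] OneForm A),
      IsPermutationPullback τ) ∧
    ∀ θ : ι → OneForm A, IsDualFamily e θ →
      ∀ τ : (OneForm A ⊗[ℂ] OneForm A) ≃ₗ[ℂ] (OneForm A ⊗[ℂ] OneForm A),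
        IsPermutationPullback τ →
        Set.BijOn (metricMatrix θ) {g | IsMetric τ g} {G | G.IsSymm} ∧
        Set.BijOn (metricMatrix θ) {g | IsMetric τ g ∧ IsMiddleLinear g}
          {G | G.IsSymm ∧ ∀ i j, G i j ∈ Subalgebra.center ℂ A} := by
  obtain ⟨b, rfl⟩ := he
  have hex := existsUnique_isDualFamily b
  obtain ⟨θ₀, hθ₀, -⟩ := id hex
  exact ⟨hex, hθ₀.exists_isPermutationPullback, fun θ hθ τ hτ =>
    ⟨hθ.bijOn_metricMatrix hτ, hθ.bijOn_metricMatrix_middleLinear hτ⟩⟩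

end FrameAlgebra

/-! ### Hadamard's lemma with smooth remainder. -/

section Hadamard

open MeasureTheory Set

/-- Hadamard's lemma: a smooth function is, up to its value at `y₀`, a smooth family of linear
maps applied to `y - y₀`. -/
theorem ContDiff.exists_hadamard {E G : Type*} [NormedAddCommGroup E] [NormedSpace ℝ E]
    [NormedAddCommGroup G] [NormedSpace ℝ G] [CompleteSpace G] {F : E → G}
    (hF : ContDiff ℝ ∞ F) (y₀ : E) :
    ∃ H : E → E →L[ℝ] G, ContDiff ℝ ∞ H ∧ H y₀ = fderiv ℝ F y₀ ∧
      ∀ y, F y = F y₀ + H y (y - y₀) := by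
  have hF' : ContDiff ℝ ∞ (fderiv ℝ F) := hF.fderiv_right (by simp)
  let K : E → ℝ → E →L[ℝ] G := fun y t => fderiv ℝ F (y₀ + t • (y - y₀))
  have hK : ContDiff ℝ ∞ (Function.uncurry K) := by
    refine hF'.comp ?_
    fun_prop
  have hKc (y : E) : Continuous (K y) := 
    hK.continuous.comp (f := fun t => (y, t)) (by fun_prop)
  refine ⟨fun y => ∫ t in (0:ℝ)..1, K y t, ?_, by simp [K], fun y => ?_⟩
  -- Smoothness in the parameter comes from convolution: the integral is the convolution at `0` of
  -- the indicator of `[0,1]` with `s ↦ ψ s • K y (-s)`. The cutoff `ψ` is `1` on `[-1,1]`, so the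
  -- integral is unchanged, and it supplies the compact support.
  · let ψ : ContDiffBump (0 : ℝ) := ⟨1, 2, one_pos, one_lt_two⟩
    have key := contDiffOn_convolution_right_with_param_comp (n := ⊤) (μ := volume)
      (ContinuousLinearMap.lsmul ℝ ℝ) (s := (univ : Set E)) (v := fun _ => (0 : ℝ))
      contDiffOn_const (f := indicator (Icc (0:ℝ) 1) fun _ => (1 : ℝ))
      (g := fun y s => ψ s • K y (-s)) (k := Metric.closedBall 0 2)
      isOpen_univ (isCompact_closedBall _ _) ?_ ?_ ?_
    · rw [contDiffOn_univ] at key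
      refine (congrArg (ContDiff ℝ ∞) (funext fun y => ?_)).mpr key
      rw [convolution, intervalIntegral.integral_of_le zero_le_one,
        ← integral_Icc_eq_integral_Ioc, ← integral_indicator measurableSet_Icc]
      refine integral_congr_ae (Filter.Eventually.of_forall fun t => ?_)
      by_cases ht : t ∈ Icc (0:ℝ) 1
      · have h1 : ψ (-t) = 1 := ψ.one_of_mem_closedBall (by
          rw [mem_closedBall_zero_iff, norm_neg, Real.norm_of_nonneg ht.1]
          exact ht.2)
        simp only [indicator_of_mem ht, ContinuousLinearMap.lsmul_apply, one_smul, zero_sub,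
          neg_neg, h1]
      · simp [indicator_of_notMem ht]
    · intro y s _ hs
      have h0 : ψ s = 0 := ψ.zero_of_le_dist (by
        rw [Metric.mem_closedBall, not_le] at hs
        exact hs.le)
      simp [h0]
    · exact (integrable_indicator_iff measurableSet_Icc |>.2
        (by simp [IntegrableOn])).locallyIntegrable
    · refine ContDiff.contDiffOn ?_
      refine ContDiff.smul (ψ.contDiff.comp contDiff_snd) ?_
      exact hK.comp (contDiff_fst.prodMk contDiff_snd.neg)
  · have hderiv : ∀ t ∈ uIcc (0:ℝ) 1,
        HasDerivAt (fun t : ℝ => F (y₀ + t • (y - y₀))) (K y t (y - y₀)) t := by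
      intro t _
      have h1 : HasDerivAt (fun t : ℝ => y₀ + t • (y - y₀)) (y - y₀) t := by
        simpa using ((hasDerivAt_id t).smul_const (y - y₀)).const_add y₀
      exact ((hF.differentiable (by simp)) _).hasFDerivAt.comp_hasDerivAt t h1
    have hint := intervalIntegral.integral_eq_sub_of_hasDerivAt hderiv
      (((hKc y).clm_apply continuous_const).intervalIntegrable 0 1)
    have happ := ContinuousLinearMap.intervalIntegral_apply
      ((hKc y).intervalIntegrable (μ := volume) 0 1) (y - y₀)
    simp only [happ, hint]
    simp

end Hadamard

/-! ### Derivations of `C^∞(M)` as combinations of a global frame. -/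

section PointDerivation

open Matrix

variable {m : ℕ} {M : Type*} [TopologicalSpace M] [ChartedSpace (EuclideanSpace ℝ (Fin m)) M]

theorem SmoothFun.smul_apply (c : ℂ) (f : SmoothFun m M) (x : M) : (c • f) x = c * f x := by
  rw [Algebra.smul_def]; rfl

/-- Evaluation at a point, as a ring homomorphism. -/
def SmoothFun.eval (x : M) : SmoothFun m M →+* ℂ where
  toFun f := f x
  map_one' := rfl
  map_mul' _ _ := rfl
  map_zero' := rfl
  map_add' _ _ := rfl

theorem SmoothFun.eval_apply (x : M) (f : SmoothFun m M) : SmoothFun.eval x f = f x := rfl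

variable [IsManifold (𝓡 m) ∞ M]

/-- A bump function times a function which is smooth in a chart, as a smooth function. -/
def SmoothBumpFunction.mulSmooth [T2Space M] {x : M} (χ : SmoothBumpFunction (𝓡 m) x) (g : M → ℂ)
    (hg : ContMDiffOn (𝓡 m) 𝓘(ℝ, ℂ) ∞ g (chartAt (EuclideanSpace ℝ (Fin m)) x).source) :
    SmoothFun m M :=
  ⟨fun y => χ y • g y, χ.contMDiff_smul hg⟩

theorem SmoothBumpFunction.mulSmooth_apply [T2Space M] {x : M}
    (χ : SmoothBumpFunction (𝓡 m) x) {g : M → ℂ}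
    (hg : ContMDiffOn (𝓡 m) 𝓘(ℝ, ℂ) ∞ g (chartAt (EuclideanSpace ℝ (Fin m)) x).source) (y : M) :
    χ.mulSmooth g hg y = χ y * g y := Complex.real_smul

theorem contMDiffOn_comp_extChartAt {G : Type*} [NormedAddCommGroup G] [NormedSpace ℝ G]
    {h : EuclideanSpace ℝ (Fin m) → G} (hh : ContDiff ℝ ∞ h) (x : M) :
    ContMDiffOn (𝓡 m) 𝓘(ℝ, G) ∞ (fun y => h (extChartAt (𝓡 m) x y))
      (chartAt (EuclideanSpace ℝ (Fin m)) x).source :=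
  hh.contMDiff.comp_contMDiffOn contMDiffOn_extChartAt

variable {x : M} {d : SmoothFun m M →ₗ[ℂ] ℂ}

section

variable (hd : ∀ f g : SmoothFun m M, d (f * g) = f x * d g + d f * g x)
include hd

theorem pointDerivation_one : d 1 = 0 := by
  have h := hd 1 1
  have h1 : (1 : SmoothFun m M) x = 1 := rfl
  rw [mul_one, h1, one_mul, mul_one] at h
  exact left_eq_add.1 h

/-- With a bump `b` supported where `f` vanishes, `0 = d (b f) = b(x) d f + d b f(x) = d f`. -/
theorem pointDerivation_eq_zero_of_eventuallyEq [T2Space M] {f : SmoothFun m M}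
    (hf : ∀ᶠ y in nhds x, f y = 0) : d f = 0 := by
  obtain ⟨χ, hχ, -⟩ := (SmoothBumpFunction.nhds_basis_support (I := 𝓡 m) hf).mem_iff.1 hf
  let b : SmoothFun m M := χ.mulSmooth (fun _ => 1) contMDiffOn_const
  have hb (y : M) : b y = χ y := by rw [SmoothBumpFunction.mulSmooth_apply, mul_one]
  have hbf : b * f = 0 := by
    ext y
    change b y * f y = 0
    by_cases hy : y ∈ tsupport χ
    · have : f y = 0 := hχ hy
      rw [this, mul_zero]
    · rw [hb, image_eq_zero_of_notMem_tsupport hy, Complex.ofReal_zero, zero_mul]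
  have h := hd b f
  rw [hbf, map_zero, hb, χ.eq_one, hf.self_of_nhds, mul_zero, add_zero, Complex.ofReal_one,
    one_mul] at h
  exact h.symm

theorem pointDerivation_congr [T2Space M] {f g : SmoothFun m M}
    (hf : ∀ᶠ y in nhds x, f y = g y) : d f = d g := by
  rw [← sub_eq_zero, ← map_sub]
  exact pointDerivation_eq_zero_of_eventuallyEq hd (hf.mono fun y hy => sub_eq_zero.2 hy)

end

/-- A smooth function agrees near any point with a smooth function of the coordinates. -/
theorem exists_contDiff_eventuallyEq_comp_extChartAt (f : SmoothFun m M) (x : M) :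
    ∃ F : EuclideanSpace ℝ (Fin m) → ℂ, ContDiff ℝ ∞ F ∧
      f =ᶠ[nhds x] fun y => F (extChartAt (𝓡 m) x y) := by
  let χ : SmoothBumpFunction (𝓡 m) x := Classical.arbitrary _
  -- The cutoff is made in the model space, so that `F` is smooth on all of it, as
  -- `ContDiff.exists_hadamard` requires.
  refine ⟨fun y => χ.toContDiffBump y • f ((extChartAt (𝓡 m) x).symm y), ?_, ?_⟩
  · rw [contDiff_iff_contDiffAt]
    intro y
    by_cases hy : y ∈ tsupport χ.toContDiffBump
    · rw [χ.toContDiffBump.tsupport_eq] at hy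
      have hy' : y ∈ (extChartAt (𝓡 m) x).target := χ.closedBall_subset ⟨hy, by simp⟩
      have h := (f.contMDiff.comp_contMDiffOn (contMDiffOn_extChartAt_symm (I := 𝓡 m) x)).contMDiffAt
        ((isOpen_extChartAt_target x).mem_nhds hy')
      exact χ.toContDiffBump.contDiffAt.smul h.contDiffAt
    · refine contDiffAt_const (c := 0) |>.congr_of_eventuallyEq ?_
      filter_upwards [notMem_tsupport_iff_eventuallyEq.1 hy] with z hz
      rw [hz, Pi.zero_apply, zero_smul]
  · have h1 : ∀ᶠ y in nhds x, y ∈ (extChartAt (𝓡 m) x).source :=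
      extChartAt_source_mem_nhds x
    filter_upwards [h1, χ.eventuallyEq_one] with y hy hχ
    have hy' : y ∈ (chartAt (EuclideanSpace ℝ (Fin m)) x).source := by
      rwa [extChartAt_source] at hy
    have h2 : χ.toContDiffBump (extChartAt (𝓡 m) x y) = 1 := by
      exact (χ.eqOn_source hy').symm.trans hχ
    rw [h2, one_smul, (extChartAt (𝓡 m) x).left_inv hy]

theorem mfderiv_of_eventuallyEq_comp_extChartAt {f : M → ℂ} {F : EuclideanSpace ℝ (Fin m) → ℂ}
    (hF : ContDiff ℝ ∞ F) {x : M} (hf : f =ᶠ[nhds x] fun y => F (extChartAt (𝓡 m) x y)) :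
    mfderiv (𝓡 m) 𝓘(ℝ, ℂ) f x = fderiv ℝ F (extChartAt (𝓡 m) x x) := by
  rw [hf.mfderiv_eq]
  have h1 : MDifferentiableAt 𝓘(ℝ, EuclideanSpace ℝ (Fin m)) 𝓘(ℝ, ℂ) F (extChartAt (𝓡 m) x x) :=
    (hF.differentiable (by simp) _).mdifferentiableAt
  have h2 : MDifferentiableAt (𝓡 m) 𝓘(ℝ, EuclideanSpace ℝ (Fin m)) (extChartAt (𝓡 m) x) x :=
    mdifferentiableAt_extChartAt (mem_chart_source _ x)
  refine (mfderiv_comp x h1 h2).trans ?_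
  rw [mfderiv_extChartAt_self, mfderiv_eq_fderiv]
  rfl

/-- Hadamard's lemma writes `f` near `x` as `f(x) + ∑ p i * q i`. Both factors vanish at `x`: `p i`
is a centred coordinate, and `q i (x)` is a partial derivative of `f`. The Leibniz rule then kills
each product. -/
theorem pointDerivation_eq_zero_of_mfderiv_eq_zero [T2Space M]
    (hd : ∀ f g : SmoothFun m M, d (f * g) = f x * d g + d f * g x) {f : SmoothFun m M}
    (hf : mfderiv (𝓡 m) 𝓘(ℝ, ℂ) f x = 0) : d f = 0 := by
  obtain ⟨F, hF, hfF⟩ := exists_contDiff_eventuallyEq_comp_extChartAt f x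
  rw [mfderiv_of_eventuallyEq_comp_extChartAt hF hfF] at hf
  obtain ⟨H, hH, hH0, hFH⟩ := hF.exists_hadamard (extChartAt (𝓡 m) x x)
  rw [hf] at hH0
  let χ : SmoothBumpFunction (𝓡 m) x := Classical.arbitrary _
  let φ := extChartAt (𝓡 m) x
  let p (i : Fin m) : SmoothFun m M := χ.mulSmooth
    (fun y => (((φ y - φ x) i : ℝ) : ℂ)) (contMDiffOn_comp_extChartAt
      (h := fun z : EuclideanSpace ℝ (Fin m) => (((z - φ x) i : ℝ) : ℂ)) (by
        exact Complex.ofRealCLM.contDiff.comp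
          ((EuclideanSpace.proj (𝕜 := ℝ) i).contDiff.comp (contDiff_id.sub contDiff_const))) x)
  let q (i : Fin m) : SmoothFun m M := χ.mulSmooth
    (fun y => H (φ y) (EuclideanSpace.single i 1)) (contMDiffOn_comp_extChartAt
      (h := fun z => H z (EuclideanSpace.single i 1)) (hH.clm_apply contDiff_const) x)
  have hp (i : Fin m) (y : M) : p i y = χ y * ((φ y - φ x) i : ℝ) :=
    SmoothBumpFunction.mulSmooth_apply _ _ _
  have hq (i : Fin m) (y : M) : q i y = χ y * H (φ y) (EuclideanSpace.single i 1) :=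
    SmoothBumpFunction.mulSmooth_apply _ _ _
  have hp0 (i : Fin m) : p i x = 0 := by simp [hp]
  have hq0 (i : Fin m) : q i x = 0 := by
    rw [hq]
    change _ * H (extChartAt (𝓡 m) x x) _ = 0
    rw [hH0]
    exact mul_zero _
  have key : d f = d (f x • 1 + ∑ i, p i * q i) := by
    refine pointDerivation_congr hd ?_
    filter_upwards [hfF, χ.eventuallyEq_one] with y hy hχ
    have hsum : (f x • 1 + ∑ i, p i * q i : SmoothFun m M) y = f x + ∑ i, p i y * q i y := by
      have h1 : (f x • (1 : SmoothFun m M)) y = f x := by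
        rw [SmoothFun.smul_apply]
        exact mul_one _
      rw [← SmoothFun.eval_apply, map_add, map_sum]
      simp only [map_mul, SmoothFun.eval_apply, h1]
    rw [hsum, hy, hfF.self_of_nhds, hFH]
    congr 1
    conv_lhs => rw [← (EuclideanSpace.basisFun (Fin m) ℝ).sum_repr (φ y - φ x), map_sum]
    refine Finset.sum_congr rfl fun i _ => ?_
    rw [hp, hq, hχ, map_smul, Complex.real_smul, EuclideanSpace.basisFun_repr,
      EuclideanSpace.basisFun_apply, Pi.one_apply, Complex.ofReal_one, one_mul, one_mul]
  rw [key, map_add, map_smul, pointDerivation_one hd, smul_zero, zero_add, map_sum]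
  refine Finset.sum_eq_zero fun i _ => ?_
  rw [hd, hp0, hq0, zero_mul, mul_zero, add_zero]

/-- The derivation of `C^∞(M)` given by a vector field. -/
def SmoothVF.derivation (V : SmoothVF m M) : Derivation ℂ (SmoothFun m M) (SmoothFun m M) :=
  Derivation.mk'
    { toFun := V.apply
      map_add' := V.apply_add
      map_smul' := fun c f => by
        have h : V.apply (SmoothFun.const m M c * f) = SmoothFun.const m M c * V.apply f := by
          rw [V.apply_mul, V.apply_const, zero_mul, zero_add]
        exact h }
    fun f g => by
      change V.apply (f * g) = f * V.apply g + g * V.apply f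
      rw [V.apply_mul, add_comm, mul_comm g]

theorem SmoothVF.derivation_apply (V : SmoothVF m M) (f : SmoothFun m M) (x : M) :
    V.derivation f x = mfderiv (𝓡 m) 𝓘(ℝ, ℂ) f x (V x) := rfl

/-- The `u i` are cut-off chart coordinates, so at `x` the matrix consists of the components of the
frame vectors. Its determinant is the denominator in Cramer's rule for the coefficients of a
derivation. -/
theorem exists_det_frame_ne_zero [T2Space M] {e : Fin m → SmoothVF m M} {x : M}
    (he : LinearIndependent ℝ fun α => e α x) :
    ∃ u : Fin m → SmoothFun m M,
      (Matrix.of fun α i => (e α).derivation (u i)).det x ≠ 0 := by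
  let χ : SmoothBumpFunction (𝓡 m) x := Classical.arbitrary _
  have hF (i : Fin m) : ContDiff ℝ ∞ fun z : EuclideanSpace ℝ (Fin m) => ((z i : ℝ) : ℂ) :=
    Complex.ofRealCLM.contDiff.comp (EuclideanSpace.proj (𝕜 := ℝ) i).contDiff
  refine ⟨fun i => χ.mulSmooth _ (contMDiffOn_comp_extChartAt (hF i) x), ?_⟩
  let R : Matrix (Fin m) (Fin m) ℝ := Matrix.of fun α => WithLp.ofLp (e α x)
  have hR : R.det ≠ 0 := by
    have h : LinearIndependent ℝ R.row :=
      he.map' (WithLp.linearEquiv 2 ℝ (Fin m → ℝ)).toLinearMap (LinearEquiv.ker _)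
    rw [Matrix.linearIndependent_rows_iff_isUnit, Matrix.isUnit_iff_isUnit_det] at h
    exact h.ne_zero
  rw [← SmoothFun.eval_apply, RingHom.map_det]
  have hmap : (SmoothFun.eval x).mapMatrix (Matrix.of fun α i => (e α).derivation
      (χ.mulSmooth _ (contMDiffOn_comp_extChartAt (hF i) x))) = Complex.ofRealHom.mapMatrix R := by
    ext α i
    have hev : (χ.mulSmooth _ (contMDiffOn_comp_extChartAt (hF i) x) : M → ℂ) =ᶠ[nhds x]
        fun y => ((extChartAt (𝓡 m) x y i : ℝ) : ℂ) := by
      filter_upwards [χ.eventuallyEq_one] with y hχ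
      rw [SmoothBumpFunction.mulSmooth_apply, hχ, Pi.one_apply, Complex.ofReal_one, one_mul]
    change (e α).derivation _ x = ((e α x).ofLp i : ℂ)
    rw [SmoothVF.derivation_apply, mfderiv_of_eventuallyEq_comp_extChartAt (hF i) hev]
    have hfd : HasFDerivAt (fun z : EuclideanSpace ℝ (Fin m) => ((z i : ℝ) : ℂ))
        (Complex.ofRealCLM ∘L EuclideanSpace.proj (𝕜 := ℝ) i) (extChartAt (𝓡 m) x x) :=
      (Complex.ofRealCLM ∘L EuclideanSpace.proj (𝕜 := ℝ) i).hasFDerivAt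
    rw [hfd.fderiv]
    rfl
  rw [hmap, ← RingHom.map_det]
  simpa using hR

theorem pointDerivation_eq_zero_of_frame [T2Space M]
    (hd : ∀ f g : SmoothFun m M, d (f * g) = f x * d g + d f * g x)
    {e : Fin m → SmoothVF m M} (he : LinearIndependent ℝ fun α => e α x)
    {f : SmoothFun m M} (hf : ∀ α, (e α).derivation f x = 0) : d f = 0 := by
  refine pointDerivation_eq_zero_of_mfderiv_eq_zero hd ?_
  have : FiniteDimensional ℝ (TangentSpace (𝓡 m) x) :=
    inferInstanceAs (FiniteDimensional ℝ (EuclideanSpace ℝ (Fin m)))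
  have hspan := he.span_eq_top_of_card_eq_finrank' (by
    rw [Fintype.card_fin]; exact (finrank_euclideanSpace_fin (𝕜 := ℝ)).symm)
  have h : (mfderiv (𝓡 m) 𝓘(ℝ, ℂ) f x).toLinearMap = 0 :=
    LinearMap.ext_on_range hspan fun α => hf α
  exact ContinuousLinearMap.coe_injective h

/-- Every point derivation is determined by finitely many of its values, through the values of the
frame. -/
theorem pointDerivation_eq_sum [T2Space M]
    (hd : ∀ f g : SmoothFun m M, d (f * g) = f x * d g + d f * g x)
    {e : Fin m → SmoothVF m M} (he : LinearIndependent ℝ fun α => e α x)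
    (u : Fin m → SmoothFun m M)
    (hu : (Matrix.of fun α i => (e α).derivation (u i) x).det ≠ 0) (f : SmoothFun m M) :
    d f = ∑ α, ((fun i => d (u i)) ᵥ* (Matrix.of fun α i => (e α).derivation (u i) x)⁻¹) α *
      (e α).derivation f x := by
  set U : Matrix (Fin m) (Fin m) ℂ := Matrix.of fun α i => (e α).derivation (u i) x with hU
  have hdet : IsUnit U.det := isUnit_iff_ne_zero.2 hu
  let a : Fin m → ℂ := U⁻¹ *ᵥ fun α => (e α).derivation f x
  have ha : U *ᵥ a = fun α => (e α).derivation f x := by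
    rw [Matrix.mulVec_mulVec, Matrix.mul_nonsing_inv _ hdet, Matrix.one_mulVec]
  -- The constants `a i` are chosen so that the whole frame kills this difference at `x`.
  have h0 : d (f - ∑ i, a i • u i) = 0 := by
    refine pointDerivation_eq_zero_of_frame hd he fun α => ?_
    rw [map_sub, map_sum, ← SmoothFun.eval_apply, map_sub, map_sum, sub_eq_zero,
      SmoothFun.eval_apply, ← congrFun ha α]
    change ∑ i, U α i * a i = _
    refine Finset.sum_congr rfl fun i _ => ?_
    rw [Derivation.map_smul, SmoothFun.eval_apply, SmoothFun.smul_apply, mul_comm]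
    rfl
  rw [map_sub, sub_eq_zero] at h0
  rw [h0, map_sum]
  change _ = (_ ᵥ* U⁻¹) ⬝ᵥ fun α => (e α).derivation f x
  rw [← Matrix.dotProduct_mulVec]
  refine Finset.sum_congr rfl fun i _ => ?_
  rw [map_smul, smul_eq_mul, mul_comm]

theorem frame_linearIndependent [T2Space M] {e : Fin m → SmoothVF m M}
    (he : ∀ x : M, LinearIndependent ℝ fun α => e α x) {c : Fin m → SmoothFun m M}
    (hc : ∀ f, ∑ α, c α * (e α).derivation f = 0) : c = 0 := by
  funext α
  ext x
  obtain ⟨u, hu⟩ := exists_det_frame_ne_zero (he x)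
  have h : (fun α => c α x) ᵥ* (SmoothFun.eval x).mapMatrix
      (Matrix.of fun α i => (e α).derivation (u i)) = 0 := by
    funext i
    have := congrArg (SmoothFun.eval x) (hc (u i))
    rw [map_sum, map_zero] at this
    exact this
  have h0 := Matrix.eq_zero_of_vecMul_eq_zero (by rwa [← RingHom.map_det, SmoothFun.eval_apply]) h
  exact congrFun h0 α

/-- Coefficients exist pointwise. Near `x₀` they solve the linear system given by fixed test
functions `u i`, so by Cramer's rule they are smooth functions divided by a nonvanishing
determinant. -/
theorem exists_smooth_coeff [T2Space M] {e : Fin m → SmoothVF m M}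
    (he : ∀ x : M, LinearIndependent ℝ fun α => e α x)
    (D : Derivation ℂ (SmoothFun m M) (SmoothFun m M)) :
    ∃ c : Fin m → SmoothFun m M, ∀ f, D f = ∑ α, c α * (e α).derivation f := by
  have hex (x : M) : ∃ c : Fin m → ℂ, ∀ f, D f x = ∑ α, c α * (e α).derivation f x := by
    obtain ⟨u, hu⟩ := exists_det_frame_ne_zero (he x)
    rw [← SmoothFun.eval_apply, RingHom.map_det] at hu
    let d : SmoothFun m M →ₗ[ℂ] ℂ :=
      { toFun := fun f => D f x
        map_add' := fun f g => by rw [map_add]; rfl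
        map_smul' := fun c f => by rw [D.map_smul, SmoothFun.smul_apply]; rfl }
    have hd (f g : SmoothFun m M) : d (f * g) = f x * d g + d f * g x := by
      change D (f * g) x = _
      rw [D.leibniz, mul_comm (d f)]
      rfl
    exact ⟨_, pointDerivation_eq_sum hd (he x) u hu⟩
  choose c hc using hex
  have hsmooth (α : Fin m) : ContMDiff (𝓡 m) 𝓘(ℝ, ℂ) ∞ fun x => c x α := by
    intro x₀
    obtain ⟨u, hu⟩ := exists_det_frame_ne_zero (he x₀)
    set U : Matrix (Fin m) (Fin m) (SmoothFun m M) :=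
      Matrix.of fun α i => (e α).derivation (u i) with hU
    let w : Fin m → SmoothFun m M := (fun i => D (u i)) ᵥ* U.adjugate
    have hw (x : M) : U.det x * c x α = w α x := by
      have h1 : (fun i => D (u i) x) = c x ᵥ* (SmoothFun.eval x).mapMatrix U :=
        funext fun i => hc x (u i)
      have h2 : w α x = ((fun i => D (u i) x) ᵥ* ((SmoothFun.eval x).mapMatrix U).adjugate) α := by
        rw [← RingHom.map_adjugate]
        exact map_sum (SmoothFun.eval x) _ _
      rw [h2, h1, vecMul_vecMul, mul_adjugate, vecMul_smul, vecMul_one, ← RingHom.map_det]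
      rfl
    have hinv : ContMDiffAt (𝓡 m) 𝓘(ℝ, ℂ) ∞ (fun x => (U.det x)⁻¹) x₀ :=
      (contDiffAt_inv ℝ hu).contMDiffAt.comp x₀ U.det.contMDiff.contMDiffAt
    refine (hinv.mul (w α).contMDiff.contMDiffAt).congr_of_eventuallyEq ?_
    filter_upwards [U.det.contMDiff.continuous.continuousAt.eventually_ne hu] with x hx
    exact (eq_inv_mul_iff_mul_eq₀ hx).2 (hw x)
  refine ⟨fun α => ⟨fun x => c x α, hsmooth α⟩, fun f => ?_⟩
  ext x
  rw [hc x f, ← SmoothFun.eval_apply, map_sum]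
  rfl

end PointDerivation

/-! ### Derivations of `M_n(C)` for a commutative `ℂ`-algebra `C`. -/

section MatrixDerivation

open Matrix

theorem innerDer_apply {A : Type*} [Ring A] [Algebra ℂ A] (a b : A) :
    (innerDer a).1 b = a * b - b * a := rfl

/-- Evaluation of derivations at an element of the algebra. -/
def Der.evalAt {A : Type*} [Ring A] [Algebra ℂ A] (a : A) : Der A →ₗ[Zcenter A] A where
  toFun D := D.1 a
  map_add' _ _ := rfl
  map_smul' _ _ := rfl

theorem Der.ext_evalAt {A : Type*} [Ring A] [Algebra ℂ A] {D D' : Der A}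
    (h : ∀ a, Der.evalAt a D = Der.evalAt a D') : D = D' :=
  Subtype.ext (LinearMap.ext h)

theorem Der.exists_basis {A : Type*} [Ring A] [Algebra ℂ A] {ι : Type*} [Fintype ι]
    (e : ι → Der A)
    (hli : ∀ z : ι → Zcenter A, (∀ a, ∑ i, (z i : A) * (e i).1 a = 0) → z = 0)
    (hspan : ∀ D : Der A, ∃ z : ι → Zcenter A, ∀ a, D.1 a = ∑ i, (z i : A) * (e i).1 a) :
    ∃ b : Module.Basis ι (Zcenter A) (Der A), ⇑b = e := by
  have hsum (z : ι → Zcenter A) (a : A) :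
      Der.evalAt a (∑ i, z i • e i) = ∑ i, (z i : A) * (e i).1 a := by
    rw [map_sum]
    rfl
  let T := Fintype.linearCombination (Zcenter A) e
  have hT (z : ι → Zcenter A) (a : A) : Der.evalAt a (T z) = ∑ i, (z i : A) * (e i).1 a := by
    rw [← hsum, Fintype.linearCombination_apply]
  have hinj : Function.Injective T := by
    intro z z' h
    refine sub_eq_zero.1 (hli (z - z') fun a => ?_)
    have h1 : ∑ i, (z i : A) * (e i).1 a = ∑ i, (z' i : A) * (e i).1 a := by
      rw [← hT, h, hT]
    rw [← sub_eq_zero, ← Finset.sum_sub_distrib] at h1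
    rw [← h1]
    exact Finset.sum_congr rfl fun i _ => sub_mul _ _ _
  have hsurj : Function.Surjective T := fun D => by
    obtain ⟨z, hz⟩ := hspan D
    exact ⟨z, Der.ext_evalAt fun a => (hT z a).trans (hz a).symm⟩
  classical
  refine ⟨Module.Basis.ofEquivFun (LinearEquiv.ofBijective T ⟨hinj, hsurj⟩).symm,
    funext fun i => ?_⟩
  rw [Module.Basis.coe_ofEquivFun]
  exact (Fintype.linearCombination_apply_single _ e i 1).trans (one_smul _ _)

/-- The inclusion of the traceless matrices. -/
def slInclusion (n : ℕ) :
    LieAlgebra.SpecialLinear.sl (Fin n) ℂ →ₗ[ℂ] Matrix (Fin n) (Fin n) ℂ where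
  toFun s := s
  map_add' _ _ := rfl
  map_smul' _ _ := rfl

variable {n : ℕ} {C : Type*} [CommRing C] [Algebra ℂ C]

/-- A scalar matrix as an element of the centre. -/
def scalarCenter (n : ℕ) (c : C) : Zcenter (Matrix (Fin n) (Fin n) C) :=
  ⟨algebraMap C _ c, Subalgebra.mem_center_iff.2 fun a => (Algebra.commutes c a).symm⟩

theorem scalarCenter_mul (c : C) (a : Matrix (Fin n) (Fin n) C) :
    (scalarCenter n c : Matrix (Fin n) (Fin n) C) * a = c • a :=
  (Algebra.smul_def c a).symm

theorem exists_eq_algebraMap_of_commute {a : Matrix (Fin n) (Fin n) C}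
    (ha : ∀ b, b * a = a * b) : ∃ c : C, a = algebraMap C _ c := by
  obtain ⟨c, hc⟩ := mem_range_scalar_iff_commute_single'.2 fun i j => ha (single i j 1)
  exact ⟨c, hc.symm⟩

theorem exists_eq_scalarCenter (z : Zcenter (Matrix (Fin n) (Fin n) C)) :
    ∃ c : C, z = scalarCenter n c := by
  obtain ⟨c, hc⟩ := exists_eq_algebraMap_of_commute fun b => Subalgebra.mem_center_iff.1 z.2 b
  exact ⟨c, Subtype.ext hc⟩

theorem Der.exists_basis_matrix {ι : Type*} [Fintype ι] (e : ι → Der (Matrix (Fin n) (Fin n) C))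
    (hli : ∀ f : ι → C, (∀ a, ∑ i, f i • (e i).1 a = 0) → f = 0)
    (hspan : ∀ D : Der (Matrix (Fin n) (Fin n) C),
      ∃ f : ι → C, ∀ a, D.1 a = ∑ i, f i • (e i).1 a) :
    ∃ b : Module.Basis ι (Zcenter (Matrix (Fin n) (Fin n) C)) (Der (Matrix (Fin n) (Fin n) C)),
      ⇑b = e := by
  refine Der.exists_basis e (fun z hz => ?_) fun D => ?_
  · choose f hf using fun i => exists_eq_scalarCenter (z i)
    have h : f = 0 := hli f fun a => by
      rw [← hz a]
      exact Finset.sum_congr rfl fun i _ => by rw [hf, scalarCenter_mul]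
    funext i
    rw [hf, h]
    exact Subtype.ext (map_zero (algebraMap C _))
  · obtain ⟨f, hf⟩ := hspan D
    refine ⟨fun i => scalarCenter n (f i), fun a => ?_⟩
    rw [hf]
    exact Finset.sum_congr rfl fun i _ => (scalarCenter_mul _ _).symm

/-- Differentiating `c b = b c` shows that `D c` is again central, hence scalar; any one diagonal
entry recovers it. -/
theorem exists_derivation_scalar (hn : 1 ≤ n) (D : Der (Matrix (Fin n) (Fin n) C)) :
    ∃ δ : Derivation ℂ C C, ∀ c, D.1 (algebraMap C _ c) = algebraMap C _ (δ c) := by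
  have hD (a b : Matrix (Fin n) (Fin n) C) : D.1 (a * b) = D.1 a * b + a * D.1 b := D.2 a b
  let i₀ : Fin n := ⟨0, hn⟩
  have hscalar (c : C) :
      D.1 (algebraMap C _ c) = algebraMap C _ (D.1 (algebraMap C _ c) i₀ i₀) := by
    obtain ⟨c', hc'⟩ := exists_eq_algebraMap_of_commute (a := D.1 (algebraMap C _ c)) fun b => by
      have h := congrArg D.1 (Algebra.commutes c b)
      rw [hD, hD, Algebra.commutes c (D.1 b), add_comm (D.1 b * _)] at h
      exact (add_right_cancel h).symm
    rw [hc']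
    simp [algebraMap_matrix_apply]
  refine ⟨Derivation.mk'
    { toFun := fun c => D.1 (algebraMap C _ c) i₀ i₀
      map_add' := fun c c' => by rw [map_add, map_add]; rfl
      map_smul' := fun z c => by
        have h : algebraMap C (Matrix (Fin n) (Fin n) C) (z • c) = z • algebraMap C _ c := by
          rw [Algebra.algebraMap_eq_smul_one, smul_assoc, ← Algebra.algebraMap_eq_smul_one]
        rw [h, map_smul]; rfl } fun c c' => ?_, hscalar⟩
  change D.1 (algebraMap C _ (c * c')) i₀ i₀ = c • (D.1 (algebraMap C _ c') i₀ i₀) +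
    c' • (D.1 (algebraMap C _ c) i₀ i₀)
  rw [map_mul, hD, ← Algebra.commutes c', ← Algebra.smul_def, ← Algebra.smul_def, add_comm]
  rfl

theorem exists_commutator_of_scalar_eq_zero (hn : 1 ≤ n)
    (D : Matrix (Fin n) (Fin n) C →+ Matrix (Fin n) (Fin n) C)
    (hD : ∀ a b, D (a * b) = D a * b + a * D b) (h0 : ∀ c : C, D (algebraMap C _ c) = 0) :
    ∃ u : Matrix (Fin n) (Fin n) C, u.trace = 0 ∧ ∀ a, D a = u * a - a * u := by
  have hsmul (c : C) (a : Matrix (Fin n) (Fin n) C) : D (c • a) = c • D a := by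
    rw [Algebra.smul_def, hD, h0, zero_mul, zero_add, ← Algebra.smul_def]
  let i₀ : Fin n := ⟨0, hn⟩
  -- Computing `∑ k, D (a E_{k0}) E_{0k}` by the Leibniz rule gives `D a + a u`; expanding `a
  -- E_{k0}` in the `E_{j0}` and using `C`-linearity gives `u a`.
  let u : Matrix (Fin n) (Fin n) C := ∑ k, D (single k i₀ 1) * single i₀ k 1
  have hone : ∑ k, single k i₀ (1 : C) * single i₀ k 1 = 1 := by
    ext p q
    simp [Matrix.sum_apply, single_apply, Matrix.one_apply, ite_and]
  have hleft (a : Matrix (Fin n) (Fin n) C) (k : Fin n) :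
      a * single k i₀ 1 = ∑ j, a j k • single j i₀ 1 := by
    ext p q
    simp [Matrix.sum_apply, single_apply, Matrix.mul_apply, ite_and]
  have hright (a : Matrix (Fin n) (Fin n) C) (j : Fin n) :
      single i₀ j 1 * a = ∑ k, a j k • single i₀ k 1 := by
    ext p q
    simp [Matrix.sum_apply, single_apply, Matrix.mul_apply, ite_and]
  have hu (a : Matrix (Fin n) (Fin n) C) : D a = u * a - a * u := by
    have h1 : ∑ k, D (a * single k i₀ 1) * single i₀ k 1 = D a + a * u := by
      simp only [hD, add_mul, Finset.sum_add_distrib, mul_assoc, ← Finset.mul_sum, hone, mul_one, u]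
    have h2 : ∑ k, D (a * single k i₀ 1) * single i₀ k 1 = u * a := by
      simp only [u, Finset.sum_mul, mul_assoc, hright, hleft, map_sum, hsmul, Finset.mul_sum,
        smul_mul_assoc, mul_smul_comm]
      exact Finset.sum_comm
    rw [eq_sub_iff_add_eq, ← h1, h2]
  have hn0 : (n : ℂ) ≠ 0 := by exact_mod_cast (by omega : n ≠ 0)
  -- Subtracting a scalar matrix leaves the commutator unchanged and removes the trace.
  refine ⟨u - algebraMap C _ ((n : ℂ)⁻¹ • u.trace), ?_, ?_⟩
  · have : (algebraMap C (Matrix (Fin n) (Fin n) C) ((n : ℂ)⁻¹ • u.trace)).trace = u.trace := by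
      rw [Algebra.algebraMap_eq_smul_one, trace_smul, trace_one, Fintype.card_fin, smul_eq_mul,
        smul_mul_assoc, mul_comm, ← nsmul_eq_mul, ← Nat.cast_smul_eq_nsmul ℂ, smul_smul,
        inv_mul_cancel₀ hn0, one_smul]
    rw [trace_sub, this, sub_self]
  · intro a
    rw [hu, sub_mul, mul_sub, Algebra.commutes]
    abel

/-- The constant matrices `t i j = E_{ij} - δ_{ij}/n` are traceless, and `∑ u i j • t i j = u - (tr
u / n) = u`; expand each `t i j` in the basis over `ℂ`. -/
theorem exists_coeff_of_trace_eq_zero {κ : Type*} [Fintype κ] (hn : 1 ≤ n)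
    (lam : Module.Basis κ ℂ (LieAlgebra.SpecialLinear.sl (Fin n) ℂ))
    {u : Matrix (Fin n) (Fin n) C} (hu : u.trace = 0) :
    ∃ f : κ → C, u = ∑ r, f r • (lam r : Matrix (Fin n) (Fin n) ℂ).map (algebraMap ℂ C) := by
  have hn0 : (n : ℂ) ≠ 0 := by exact_mod_cast (by omega : n ≠ 0)
  let t (i j : Fin n) : Matrix (Fin n) (Fin n) ℂ :=
    single i j 1 - (if i = j then (n : ℂ)⁻¹ else 0) • 1
  have ht (i j : Fin n) : t i j ∈ LieAlgebra.SpecialLinear.sl (Fin n) ℂ := by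
    change (t i j).trace = 0
    by_cases h : i = j
    · subst h; simp [t, hn0]
    · simp [t, h]
  let f (r : κ) : C := ∑ i, ∑ j, u i j * algebraMap ℂ C (lam.repr ⟨t i j, ht i j⟩ r)
  refine ⟨f, ?_⟩
  have hrepr (i j p q : Fin n) : ∑ r, lam.repr ⟨t i j, ht i j⟩ r *
      (lam r : Matrix (Fin n) (Fin n) ℂ) p q = t i j p q := by
    have h := congrArg (slInclusion n)
      (lam.sum_repr ⟨t i j, ht i j⟩)
    rw [map_sum] at h
    have h' := congrFun (congrFun h p) q
    rw [Matrix.sum_apply] at h'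
    exact h'
  ext p q
  have h1 : (∑ r, f r • (lam r : Matrix (Fin n) (Fin n) ℂ).map (algebraMap ℂ C)) p q =
      ∑ i, ∑ j, u i j * algebraMap ℂ C (t i j p q) := by
    simp only [← hrepr, map_sum, map_mul, Finset.mul_sum, Matrix.sum_apply, Matrix.smul_apply,
      Matrix.map_apply, smul_eq_mul, f, Finset.sum_mul, mul_assoc]
    rw [Finset.sum_comm]
    exact Finset.sum_congr rfl fun i _ => Finset.sum_comm
  rw [h1]
  have h2 : ∑ i, u i i * (algebraMap ℂ C (n : ℂ)⁻¹ * algebraMap ℂ C ((1 : Matrix _ _ ℂ) p q)) = 0 := by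
    rw [← Finset.sum_mul]
    exact mul_eq_zero_of_left hu _
  have h3 (i j : Fin n) : u i j * algebraMap ℂ C (t i j p q) =
      (if i = p ∧ j = q then u i j else 0) - if i = j then
        u i i * (algebraMap ℂ C (n : ℂ)⁻¹ * algebraMap ℂ C ((1 : Matrix _ _ ℂ) p q)) else 0 := by
    by_cases h : i = j
    · simp [t, h, single_apply, mul_sub, apply_ite]
    · by_cases h' : i = p ∧ j = q
      · have hpq : p ≠ q := fun hpq => h (h'.1.trans (hpq.trans h'.2.symm))
        simp [t, h', hpq]
      · simp [t, h, h']
  simp only [h3, Finset.sum_sub_distrib, Finset.sum_ite_eq, Finset.mem_univ, if_true, h2, ite_and,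
    sub_zero]
  simp

/-- Composed with a linear retraction `P` of `M_n(ℂ)` onto `𝔰𝔩_n(ℂ)`, each coordinate functional
becomes a constant combination of matrix entries. It therefore also applies to `C`-valued matrices
and extracts `f s`. -/
theorem coeff_eq_zero_of_sum_eq_zero {κ : Type*} [Fintype κ]
    (lam : Module.Basis κ ℂ (LieAlgebra.SpecialLinear.sl (Fin n) ℂ)) {f : κ → C}
    (hf : ∑ r, f r • (lam r : Matrix (Fin n) (Fin n) ℂ).map (algebraMap ℂ C) = 0) : f = 0 := by
  classical
  obtain ⟨P, hP⟩ := LinearMap.exists_leftInverse_of_injective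
    (slInclusion n) (LinearMap.ker_eq_bot.2 Subtype.val_injective)
  have hdual (s r : κ) : lam.repr (lam r) s =
      ∑ p, ∑ q, (lam r : Matrix (Fin n) (Fin n) ℂ) p q * lam.repr (P (single p q 1)) s := by
    have h1 : P (lam r : Matrix (Fin n) (Fin n) ℂ) = lam r := DFunLike.congr_fun hP (lam r)
    change lam.coord s (lam r) = ∑ p, ∑ q, _ * lam.coord s (P (single p q 1))
    conv_lhs => rw [← h1, matrix_eq_sum_single (lam r : Matrix (Fin n) (Fin n) ℂ)]
    simp only [map_sum]
    refine Finset.sum_congr rfl fun p _ => Finset.sum_congr rfl fun q _ => ?_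
    have h2 : single p q ((lam r : Matrix (Fin n) (Fin n) ℂ) p q) =
        (lam r : Matrix (Fin n) (Fin n) ℂ) p q • single p q (1 : ℂ) := by
      rw [smul_single, smul_eq_mul, mul_one]
    rw [h2, map_smul, map_smul, smul_eq_mul]
  funext s
  have h1 : f s = ∑ r, f r * algebraMap ℂ C (lam.repr (lam r) s) := by
    simp [Finsupp.single_apply, apply_ite]
  have h2 (p q : Fin n) :
      ∑ r, f r * algebraMap ℂ C ((lam r : Matrix (Fin n) (Fin n) ℂ) p q) = 0 := by
    have h := congrFun (congrFun hf p) q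
    rw [Matrix.sum_apply] at h
    exact h
  rw [h1]
  simp only [hdual, map_sum, map_mul, Finset.mul_sum, ← mul_assoc]
  rw [Finset.sum_comm]
  refine Finset.sum_eq_zero fun p _ => ?_
  rw [Finset.sum_comm]
  refine Finset.sum_eq_zero fun q _ => ?_
  rw [← Finset.sum_mul, h2, zero_mul]

/-- The sum is central, hence a scalar `c`, and it is traceless, so `n c = 0` and `c = 0`. -/
theorem coeff_eq_zero_of_commute (hn : 1 ≤ n) {κ : Type*} [Fintype κ]
    (lam : Module.Basis κ ℂ (LieAlgebra.SpecialLinear.sl (Fin n) ℂ)) {f : κ → C}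
    (hf : ∀ a : Matrix (Fin n) (Fin n) C,
      a * ∑ r, f r • (lam r : Matrix (Fin n) (Fin n) ℂ).map (algebraMap ℂ C) =
        (∑ r, f r • (lam r : Matrix (Fin n) (Fin n) ℂ).map (algebraMap ℂ C)) * a) :
    f = 0 := by
  have hn0 : (n : ℂ) ≠ 0 := by exact_mod_cast (by omega : n ≠ 0)
  obtain ⟨c, hc⟩ := exists_eq_algebraMap_of_commute hf
  have h := congrArg Matrix.trace hc
  have htrace : ∑ r, (f r • (lam r : Matrix (Fin n) (Fin n) ℂ).map (algebraMap ℂ C)).trace = 0 := by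
    refine Finset.sum_eq_zero fun r _ => ?_
    have ht : (lam r : Matrix (Fin n) (Fin n) ℂ).trace = 0 := (lam r).2
    have ht' : ((lam r : Matrix (Fin n) (Fin n) ℂ).map (algebraMap ℂ C)).trace = 0 := by
      rw [← map_zero (algebraMap ℂ C), ← ht]
      exact (map_sum (algebraMap ℂ C) _ _).symm
    rw [trace_smul, ht', smul_zero]
  rw [trace_sum, htrace, Algebra.algebraMap_eq_smul_one, trace_smul, trace_one, Fintype.card_fin,
    smul_eq_mul, mul_comm, ← nsmul_eq_mul, ← Nat.cast_smul_eq_nsmul ℂ] at h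
  have hc0 : c = 0 := by
    have := congrArg (fun x => (n : ℂ)⁻¹ • x) h
    simpa only [smul_smul, inv_mul_cancel₀ hn0, one_smul, smul_zero] using this.symm
  refine coeff_eq_zero_of_sum_eq_zero lam ?_
  rw [hc, hc0, map_zero]

variable {m k : ℕ} {δ : Fin m → Derivation ℂ C C} {E : Fin m → Der (Matrix (Fin n) (Fin n) C)}

theorem sum_smul_append_innerDer (E : Fin m → Der (Matrix (Fin n) (Fin n) C))
    (l : Fin k → Matrix (Fin n) (Fin n) C) (f : Fin (m + k) → C) (a : Matrix (Fin n) (Fin n) C) :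
    ∑ i, f i • (Fin.append E (fun r => innerDer (l r)) i).1 a =
      ∑ α, f (Fin.castAdd _ α) • (E α).1 a +
        ((∑ r, f (Fin.natAdd m r) • l r) * a - a * ∑ r, f (Fin.natAdd m r) • l r) := by
  rw [Fin.sum_univ_add, Finset.sum_mul, Finset.mul_sum, ← Finset.sum_sub_distrib]
  simp only [Fin.append_left, Fin.append_right, innerDer_apply, smul_sub, smul_mul_assoc,
    mul_smul_comm]

/-- Derivations of `M_n(C)` extending a basis of the derivations of `C`, together with the inner
derivations of a basis of `𝔰𝔩_n(ℂ)`, form a basis of the derivations of `M_n(C)`. -/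
theorem Der.exists_basis_append_innerDer (hn : 1 ≤ n)
    (lam : Module.Basis (Fin k) ℂ (LieAlgebra.SpecialLinear.sl (Fin n) ℂ))
    (hE : ∀ α c, (E α).1 (algebraMap _ _ c) = algebraMap _ _ (δ α c))
    (hli : ∀ c : Fin m → C, (∀ f, ∑ α, c α * δ α f = 0) → c = 0)
    (hspan : ∀ D : Derivation ℂ C C, ∃ c : Fin m → C, ∀ f, D f = ∑ α, c α * δ α f) :
    ∃ b : Module.Basis (Fin (m + k)) (Zcenter (Matrix (Fin n) (Fin n) C))
        (Der (Matrix (Fin n) (Fin n) C)),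
      ⇑b = Fin.append E fun r =>
        innerDer ((lam r : Matrix (Fin n) (Fin n) ℂ).map (algebraMap ℂ C)) := by
  have hscalar (c : Fin m → C) (g : C) : ∑ α, c α • (E α).1 (algebraMap _ _ g) =
      algebraMap C (Matrix (Fin n) (Fin n) C) (∑ α, c α * δ α g) := by
    rw [map_sum]
    exact Finset.sum_congr rfl fun α _ => by rw [hE, map_mul, Algebra.smul_def]
  refine Der.exists_basis_matrix _ (fun f hf => ?_) fun D => ?_
  · simp only [sum_smul_append_innerDer] at hf
    -- Inner derivations vanish on scalar matrices, so testing there isolates the outer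
    -- coefficients.
    have h1 : (fun α => f (Fin.castAdd _ α)) = 0 := by
      refine hli _ fun g => ?_
      have h := hf (algebraMap C _ g)
      rw [Algebra.commutes, sub_self, add_zero, hscalar] at h
      have h' := congrFun (congrFun h ⟨0, hn⟩) ⟨0, hn⟩
      simpa [algebraMap_matrix_apply] using h'
    have h2 : (fun r => f (Fin.natAdd m r)) = 0 := by
      refine coeff_eq_zero_of_commute hn lam fun a => ?_
      have h := hf a
      simp only [funext_iff, Pi.zero_apply] at h1
      simp only [h1, zero_smul, Finset.sum_const_zero, zero_add] at h
      exact (sub_eq_zero.1 h).symm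
    funext i
    exact Fin.addCases (congrFun h1) (congrFun h2) i
  · obtain ⟨d, hd⟩ := exists_derivation_scalar hn D
    obtain ⟨c, hc⟩ := hspan d
    obtain ⟨u, hu, hDu⟩ := exists_commutator_of_scalar_eq_zero hn
      (AddMonoidHom.mk' (fun a => D.1 a - ∑ α, c α • (E α).1 a) fun a b => by
        simp only [map_add, smul_add, Finset.sum_add_distrib]
        abel)
      (fun a b => by
        have hD : D.1 (a * b) = D.1 a * b + a * D.1 b := D.2 a b
        have hEl (α : Fin m) : (E α).1 (a * b) = (E α).1 a * b + a * (E α).1 b := (E α).2 a b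
        simp only [AddMonoidHom.mk'_apply, hD, hEl, smul_add, Finset.sum_add_distrib, sub_mul,
          mul_sub, Finset.sum_mul, Finset.mul_sum, smul_mul_assoc, mul_smul_comm]
        abel)
      fun g => by
        rw [AddMonoidHom.mk'_apply, hscalar, hd, hc, sub_self]
    obtain ⟨f, rfl⟩ := exists_coeff_of_trace_eq_zero hn lam hu
    refine ⟨Fin.append c f, fun a => ?_⟩
    rw [sum_smul_append_innerDer]
    simp only [Fin.append_left, Fin.append_right]
    exact sub_eq_iff_eq_add'.1 (hDu a)

end MatrixDerivation

/-! ### The basis of derivations of the matrix-valued functions on `M`. -/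

section Frame

variable {m n : ℕ} {M : Type*} [TopologicalSpace M] [ChartedSpace (EuclideanSpace ℝ (Fin m)) M]
  [IsManifold (𝓡 m) ∞ M]

theorem SmoothVF.toDer_algebraMap (V : SmoothVF m M) (f : SmoothFun m M) :
    (V.toDer n).1 (algebraMap _ _ f) = algebraMap _ (MatFun m M n) (V.derivation f) := by
  change Matrix.map _ V.derivation = _
  ext1 i j
  by_cases h : i = j
  · subst h; simp [Matrix.algebraMap_matrix_apply]
  · simp [Matrix.algebraMap_matrix_apply, h]

/-- The derivations `e_1, …, e_{m+n²-1}` form a basis of `Der A` over the centre. -/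
theorem exists_basis_frameDer [T2Space M] (hn : 1 ≤ n) {e : Fin m → SmoothVF m M}
    (he : ∀ x : M, LinearIndependent ℝ fun α => e α x)
    (lam : Module.Basis (Fin (n ^ 2 - 1)) ℂ (LieAlgebra.SpecialLinear.sl (Fin n) ℂ)) :
    ∃ b : Module.Basis (Fin (m + (n ^ 2 - 1))) (Zcenter (MatFun m M n)) (Der (MatFun m M n)),
      ⇑b = frameDer n e lam :=
  Der.exists_basis_append_innerDer hn lam (E := fun α => (e α).toDer n)
    (fun α => (e α).toDer_algebraMap) (fun _ => frame_linearIndependent he)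
    (exists_smooth_coeff he)

end Frame

end

theorem proposition2p1 (m n : ℕ) (hn : 1 ≤ n)
    (M : Type*) [TopologicalSpace M] [T2Space M] [SecondCountableTopology M]
    [ChartedSpace (EuclideanSpace ℝ (Fin m)) M] [IsManifold (𝓡 m) ∞ M]
    (e : Fin m → SmoothVF m M) (he : ∀ x : M, LinearIndependent ℝ (fun α => e α x))
    (lam : Module.Basis (Fin (n ^ 2 - 1)) ℂ (LieAlgebra.SpecialLinear.sl (Fin n) ℂ)) :
    (∃! θ : Fin (m + (n ^ 2 - 1)) → OneForm (MatFun m M n), IsDualFamily (frameDer n e lam) θ) ∧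
    (∃ τ : (OneForm (MatFun m M n) ⊗[ℂ] OneForm (MatFun m M n)) ≃ₗ[ℂ]
        (OneForm (MatFun m M n) ⊗[ℂ] OneForm (MatFun m M n)), IsPermutationPullback τ) ∧
    ∀ θ : Fin (m + (n ^ 2 - 1)) → OneForm (MatFun m M n), IsDualFamily (frameDer n e lam) θ →
      ∀ τ : (OneForm (MatFun m M n) ⊗[ℂ] OneForm (MatFun m M n)) ≃ₗ[ℂ]
        (OneForm (MatFun m M n) ⊗[ℂ] OneForm (MatFun m M n)), IsPermutationPullback τ →
        Set.BijOn (metricMatrix θ)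
          {g | IsMetric τ g}
          {G | G.IsSymm} ∧
        Set.BijOn (metricMatrix θ)
          {g | IsMetric τ g ∧ IsMiddleLinear g}
          {G | G.IsSymm ∧ ∀ i j, G i j ∈ Subalgebra.center ℂ (MatFun m M n)} :=
  metrics_of_basis (exists_basis_frameDer hn he lam)
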